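/- Let $P_0,P_1,P_2,\ldots$ be the Pell numbers, given by $P_0=0$, $P_1=1$ and $P_n=2P_{n-1}+P_{n-2}$ for $n\ge 2$. For integers $r$, $m\ge 1$, $n\ge 0$ put $$\mathcal H_{r,m}(n)=\sum_{\substack{1\le k\le n\\ k\equiv r\ (\mathrm{mod}\ m)}}\frac1k .$$ Suppose that $p>3$ is a prime, and let $\left(\frac{2}{p}\right)$ denote the Legendre symbol. Then $$\mathcal H_{p,8}(p-1)\equiv\frac{2^{2p-4}+2^{p-3}+2^{\frac{p-3}{2}}P_p-1}{p}-\frac{2^{4p-6}+2^{2p-4}+2^{p-2}P_{2p-\left(\frac 2p\right)}-1}{4p}\pmod{p^2},$$ where two rational numbers are called congruent modulo $p^2$ if their difference is $p^2$ times a rational number whose denominator is prime to $p$. -/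

import Mathlib

/-- The Pell numbers: `P 0 = 0`, `P 1 = 1`, `P (n + 2) = 2 * P (n + 1) + P n`. -/
def pellNumber : ℕ → ℕ
  | 0 => 0
  | 1 => 1
  | n + 2 => 2 * pellNumber (n + 1) + pellNumber n

/-- The restricted harmonic sum of `1 / k` over `1 ≤ k ≤ n` with `k ≡ r (mod m)`. -/
def harmonicSumMod (r : ℤ) (m n : ℕ) : ℚ :=
  ∑ k ∈ (Finset.Icc 1 n).filter (fun k : ℕ => (k : ℤ) ≡ r [ZMOD (m : ℤ)]), 1 / (k : ℚ)

/-- Congruence of rational numbers modulo a positive integer `n`: the difference is `n` times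
a rational number whose denominator is coprime to `n`. -/
def RatModEq (n : ℕ) (a b : ℚ) : Prop :=
  ∃ c : ℚ, Nat.Coprime c.den n ∧ a - b = (n : ℚ) * c

/-! For odd `j < p`, `j * C(np, j) = np * C(np - 1, j - 1)`, and `2 C(p-1, m) - C(2p-1, m)` cancels
the term of order `p`. Hence `1/j ≡ (8 C(p, j) - 2 C(2p, j)) / (4p)` modulo `p ^ 2`. Let `s` and `t`
be the sums of `C(2p, j)` and `C(p, j)` over `0 < j < p`, `j ≡ p (mod 8)`. It remains to find `8t -
2s = 4s - (6s - 8t)` modulo `p ^ 3`.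

Characters of `ℤ/8ℤ` evaluate `s` exactly up to the central coefficient, which Wolstenholme's
theorem replaces by `2`. For `6s - 8t`, put `A = 1 + X ^ p` and `(1 + X) ^ p = A + e` with `p ∣ e`;
modulo `e ^ 3`, `(A + e) ^ 4` is a combination of `A ^ 2 (A + e) ^ 2`, `A ^ 3 (A + e)` and `A ^ 4`.
A weighted sum over row `4p` thus reduces to rows `2p` and `p`, and a suitable weight makes it `6s -
8t`. Pell numbers enter through the eigenvalues `2 ± √2`. -/

/-! ### Wolstenholme's theorem -/

/-- `C(p - 1, i)` squares to `1` modulo a prime `p`. -/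
lemma sq_choose_pred_prime {p : ℕ} [Fact p.Prime] {i : ℕ} (hi : i < p) :
    ((p - 1).choose i : ZMod p) ^ 2 = 1 := by
  have hp : 0 < p := (Fact.out : p.Prime).pos
  induction i with
  | zero => simp
  | succ i ih =>
    have h1 : ((p - 1).choose i : ZMod p) + ((p - 1).choose (i + 1) : ZMod p) = 0 := by
      rw [← Nat.cast_add, ← Nat.choose_succ_succ, Nat.succ_eq_add_one,
        Nat.sub_add_cancel hp, ZMod.natCast_eq_zero_iff]
      exact (Fact.out : p.Prime).dvd_choose_self (by omega) hi
    rw [eq_neg_of_add_eq_zero_right h1, neg_sq, ih (by omega)]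

/-- The sum of the inverse squares of `1, …, p - 1` vanishes modulo a prime `p > 3`. -/
lemma sum_inv_sq_zmod {p : ℕ} [Fact p.Prime] (hp : 3 < p) :
    ∑ i ∈ Finset.Ico 1 p, ((i : ZMod p)⁻¹) ^ 2 = 0 := by
  have h1 : ∑ x : ZMod p, (x⁻¹) ^ 2 = 0 := by
    rw [show ∑ x : ZMod p, (x⁻¹) ^ 2 = ∑ x : ZMod p, x ^ 2 from
      Equiv.sum_comp inv_involutive.toPerm (fun x : ZMod p => x ^ 2)]
    apply FiniteField.sum_pow_lt_card_sub_one
    rw [ZMod.card]; omega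
  have h2 : ∑ x : ZMod p, (x⁻¹) ^ 2 = ∑ i ∈ Finset.range p, ((i : ZMod p)⁻¹) ^ 2 := by
    symm
    refine Finset.sum_bij (fun i _ => (i : ZMod p)) (by simp) ?_ ?_ (by simp)
    · intro a ha b hb hab
      rw [ZMod.natCast_eq_natCast_iff] at hab
      exact Nat.ModEq.eq_of_lt_of_lt hab (by simpa using ha) (by simpa using hb)
    · intro b _
      exact ⟨b.val, by simpa using ZMod.val_lt b, by simp⟩
  rw [h2, Finset.range_eq_Ico, Finset.sum_eq_sum_Ico_succ_bot (by omega)] at h1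
  simpa using h1

/-- Wolstenholme's theorem. -/
lemma wolstenholme {p : ℕ} [Fact p.Prime] (hp : 3 < p) :
    ((2 * p).choose p : ℤ) ≡ 2 [ZMOD (p : ℤ) ^ 3] := by
  have hpp : p.Prime := Fact.out
  have hg : ∀ i ∈ Finset.Ico 1 p, ((p.choose i / p : ℕ) : ZMod p) ^ 2 = ((i : ZMod p)⁻¹) ^ 2 := by
    intro i hi
    rw [Finset.mem_Ico] at hi
    obtain ⟨g, hg⟩ := hpp.dvd_choose_self (k := i) (by omega) hi.2
    rw [hg, Nat.mul_div_cancel_left _ hpp.pos]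
    have h1 : g * i = (p - 1).choose (i - 1) := by
      have := Nat.add_one_mul_choose_eq (p - 1) (i - 1)
      rw [Nat.sub_add_cancel hpp.pos,
        Nat.sub_add_cancel hi.1, hg, mul_assoc] at this
      exact (Nat.eq_of_mul_eq_mul_left hpp.pos this).symm
    have h2 : ((g : ZMod p) * i) ^ 2 = 1 := by
      rw [← Nat.cast_mul, h1, sq_choose_pred_prime (by omega)]
    rw [inv_pow]
    rw [mul_pow] at h2
    exact eq_inv_of_mul_eq_one_left h2
  have hs : (p : ℤ) ∣ ∑ i ∈ Finset.Ico 1 p, ((p.choose i / p : ℕ) : ℤ) ^ 2 := by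
    rw [← ZMod.intCast_zmod_eq_zero_iff_dvd]
    simp only [Int.cast_sum, Int.cast_pow, Int.cast_natCast]
    rw [Finset.sum_congr rfl hg, sum_inv_sq_zmod hp]
  -- Vandermonde: `C(2p, p) = ∑ C(p, i) ^ 2`, whose inner terms are divisible by `p ^ 2`.
  have hc : ((2 * p).choose p : ℤ)
      = 2 + (p : ℤ) ^ 2 * ∑ i ∈ Finset.Ico 1 p, ((p.choose i / p : ℕ) : ℤ) ^ 2 := by
    rw [← Nat.sum_range_choose_sq, Finset.sum_range_succ, Finset.range_eq_Ico,
      Finset.sum_eq_sum_Ico_succ_bot hpp.pos, Finset.mul_sum]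
    push_cast
    rw [Finset.sum_congr rfl (g := fun i => (p : ℤ) ^ 2 * ((p.choose i / p : ℕ) : ℤ) ^ 2)]
    · simp; ring
    · intro i hi
      rw [Finset.mem_Ico] at hi
      rw [← mul_pow, ← Nat.cast_mul, Nat.mul_div_cancel' (hpp.dvd_choose_self (by omega) hi.2)]
  obtain ⟨c, hc'⟩ := hs
  rw [hc, hc']
  refine (Int.modEq_iff_dvd.2 ⟨-c, ?_⟩)
  ring

/-! ### Reciprocals through binomial coefficients -/

/-- Two falling products compared with `(-1) ^ m * m !` to first order. -/
lemma exists_descFactorial_expansion (p m : ℕ) (hm : m < p) :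
    ∃ e a b : ℤ,
      ((p - 1).descFactorial m : ℤ) = (-1) ^ m * m.factorial + p * e + p ^ 2 * a ∧
      ((2 * p - 1).descFactorial m : ℤ) = (-1) ^ m * m.factorial + 2 * p * e + p ^ 2 * b := by
  induction m with
  | zero => exact ⟨0, 0, 0, by simp⟩
  | succ m ih =>
    obtain ⟨e, a, b, h1, h2⟩ := ih (by omega)
    rw [Nat.descFactorial_succ, Nat.descFactorial_succ, Nat.factorial_succ]
    push_cast [h1, h2, show p - 1 - m = p - (m + 1) by omega,
      show 2 * p - 1 - m = 2 * p - (m + 1) by omega, Nat.cast_sub (show m + 1 ≤ p by omega),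
      Nat.cast_sub (show m + 1 ≤ 2 * p by omega)]
    refine ⟨(-1) ^ m * m.factorial - (m + 1) * e, e + (p - (m + 1)) * a,
      4 * e + (2 * p - (m + 1)) * b, ?_, ?_⟩ <;> ring

/-- Richardson extrapolation of `C(np - 1, m)` to `n = 0`. -/
lemma two_mul_choose_sub_choose {p : ℕ} [Fact p.Prime] {m : ℕ} (hm : m < p) :
    2 * ((p - 1).choose m : ℤ) - ((2 * p - 1).choose m : ℤ) ≡ (-1) ^ m [ZMOD (p : ℤ) ^ 2] := by
  have hpp : p.Prime := Fact.out
  obtain ⟨e, a, b, h1, h2⟩ := exists_descFactorial_expansion p m hm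
  rw [Nat.descFactorial_eq_factorial_mul_choose] at h1 h2
  push_cast at h1 h2
  rw [Int.modEq_iff_dvd]
  have hcop : IsCoprime ((p : ℤ) ^ 2) (m.factorial : ℤ) := by
    apply IsCoprime.pow_left
    rw [Nat.isCoprime_iff_coprime]
    exact hpp.coprime_factorial_of_lt hm
  apply hcop.dvd_of_dvd_mul_left
  -- The first-order coefficient `e` cancels, leaving only the `p ^ 2` terms.
  exact ⟨b - 2 * a, by linear_combination 2 * (-1) * h1 + h2⟩

/-- The reciprocal of an odd `j < p` in terms of binomial coefficients. -/
lemma mul_choose_modEq {p : ℕ} [Fact p.Prime] {j : ℕ} (hj : j < p) (hodd : Odd j) :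
    (j : ℤ) * (8 * (p.choose j : ℤ) - 2 * ((2 * p).choose j : ℤ)) ≡ 4 * p [ZMOD (p : ℤ) ^ 3] := by
  have hpp : p.Prime := Fact.out
  obtain ⟨m, rfl⟩ := hodd
  have h := two_mul_choose_sub_choose (p := p) (m := 2 * m) (by omega)
  have h1 := Nat.add_one_mul_choose_eq (p - 1) (2 * m)
  have h2 := Nat.add_one_mul_choose_eq (2 * p - 1) (2 * m)
  rw [Nat.sub_add_cancel (by omega)] at h1 h2
  rw [Even.neg_one_pow (by simp), Int.modEq_iff_dvd] at h
  obtain ⟨c, hc⟩ := h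
  rw [Int.modEq_iff_dvd]
  refine ⟨4 * c, ?_⟩
  zify at h1 h2
  push_cast
  linear_combination 8 * h1 - 2 * h2 + 4 * p * hc

/-! ### Reducing row `4p` to rows `2p` and `p` -/

/-- The binomially weighted sum of `w 0, …, w N`. -/
def binSum (N : ℕ) (w : ℕ → ℤ) : ℤ := ∑ k ∈ Finset.range (N + 1), (N.choose k : ℤ) * w k

/-- The linear functional on integer polynomials with `X ^ k ↦ w k`. -/
noncomputable def coeffSum (w : ℕ → ℤ) : Polynomial ℤ →ₗ[ℤ] ℤ :=
  Polynomial.lsum fun k => LinearMap.mulRight ℤ (w k)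

lemma coeffSum_monomial (w : ℕ → ℤ) (k : ℕ) (c : ℤ) :
    coeffSum w (Polynomial.monomial k c) = c * w k := by
  simp [coeffSum, Polynomial.lsum]

open Polynomial in
lemma coeffSum_X_pow (w : ℕ → ℤ) (k : ℕ) : coeffSum w (X ^ k) = w k := by
  rw [X_pow_eq_monomial, coeffSum_monomial, one_mul]

open Polynomial in
lemma coeffSum_one_add_X_pow (w : ℕ → ℤ) (N : ℕ) : coeffSum w ((1 + X) ^ N) = binSum N w := by
  rw [add_comm, add_pow, map_sum, binSum]
  refine Finset.sum_congr rfl fun k _ => ?_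
  rw [one_pow, mul_one, ← C_eq_natCast, mul_comm, C_mul_X_pow_eq_monomial, coeffSum_monomial]

open Polynomial in
lemma coeffSum_X_pow_mul (w : ℕ → ℤ) (i : ℕ) (f : ℤ[X]) :
    coeffSum w (X ^ i * f) = coeffSum (fun k => w (i + k)) f := by
  induction f using Polynomial.induction_on' with
  | add f g hf hg => rw [mul_add, map_add, map_add, hf, hg]
  | monomial n c => rw [X_pow_mul_monomial, coeffSum_monomial, coeffSum_monomial, add_comm]

open Polynomial in
/-- Modulo `p ^ 3`, the sums over the rows `p`, `2 p` of Pascal's triangle determine those over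
row `4 p`. -/
lemma binSum_four_mul {p : ℕ} [Fact p.Prime] (w : ℕ → ℤ) :
    binSum (4 * p) w ≡
      6 * binSum (2 * p) (fun k => w k + 2 * w (p + k) + w (2 * p + k))
      - 8 * binSum p (fun k => w k + 3 * w (p + k) + 3 * w (2 * p + k) + w (3 * p + k))
      + 3 * (w 0 + 4 * w p + 6 * w (2 * p) + 4 * w (3 * p) + w (4 * p)) [ZMOD (p : ℤ) ^ 3] := by
  obtain ⟨r, hr⟩ := exists_add_pow_prime_eq (Fact.out : p.Prime) (1 : ℤ[X]) X
  -- With `e = p * X * r`: `(A + e)^4 = 6A²(A + e)² - 8A³(A + e) + 3A⁴ + 4Ae³ + e⁴`.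
  have hpoly : ((1 : ℤ[X]) + X) ^ (4 * p)
      = ((6 : ℤ) • (1 + X) ^ (2 * p) + (12 : ℤ) • (X ^ p * (1 + X) ^ (2 * p))
          + (6 : ℤ) • (X ^ (2 * p) * (1 + X) ^ (2 * p)))
        - ((8 : ℤ) • (1 + X) ^ p + (24 : ℤ) • (X ^ p * (1 + X) ^ p)
          + (24 : ℤ) • (X ^ (2 * p) * (1 + X) ^ p) + (8 : ℤ) • (X ^ (3 * p) * (1 + X) ^ p))
        + ((3 : ℤ) • X ^ 0 + (12 : ℤ) • X ^ p + (18 : ℤ) • X ^ (2 * p) + (12 : ℤ) • X ^ (3 * p)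
          + (3 : ℤ) • X ^ (4 * p))
        + ((p : ℤ) ^ 3) • (4 * (1 + X ^ p) * (X * r) ^ 3 + (p : ℤ[X]) * (X * r) ^ 4) := by
    simp only [zsmul_eq_mul, mul_comm _ p, pow_mul, hr]
    push_cast
    ring
  rw [← coeffSum_one_add_X_pow, hpoly]
  simp only [map_add, map_sub, map_smul, coeffSum_X_pow_mul, coeffSum_one_add_X_pow,
    coeffSum_X_pow, smul_eq_mul]
  rw [Int.modEq_iff_dvd]
  simp only [binSum, mul_add, Finset.sum_add_distrib, mul_left_comm _ (2 : ℤ),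
    mul_left_comm _ (3 : ℤ), ← Finset.mul_sum]
  refine ⟨-coeffSum w (4 * (1 + X ^ p) * (X * r) ^ 3 + (p : ℤ[X]) * (X * r) ^ 4), ?_⟩
  simp only [mul_add, map_add]
  ring

lemma binSum_two_mul_split {p : ℕ} (hp : 0 < p) (v : ℕ → ℤ) :
    binSum (2 * p) v = v 0 + v (2 * p) + ((2 * p).choose p : ℤ) * v p
      + ∑ j ∈ Finset.Ico 1 p, ((2 * p).choose j : ℤ) * (v j + v (2 * p - j)) := by
  rw [binSum, Finset.sum_range_succ, Finset.range_eq_Ico,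
    ← Finset.sum_Ico_consecutive _ (Nat.zero_le (p + 1)) (by omega),
    Finset.sum_Ico_succ_top (Nat.zero_le p), Finset.sum_eq_sum_Ico_succ_bot hp]
  have h : ∑ k ∈ Finset.Ico (p + 1) (2 * p), ((2 * p).choose k : ℤ) * v k
      = ∑ j ∈ Finset.Ico 1 p, ((2 * p).choose j : ℤ) * v (2 * p - j) := by
    refine Finset.sum_bij' (fun k _ => 2 * p - k) (fun k _ => 2 * p - k) ?_ ?_ ?_ ?_ ?_
    · intro k hk; rw [Finset.mem_Ico] at hk ⊢; omega
    · intro k hk; rw [Finset.mem_Ico] at hk ⊢; omega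
    · intro k hk; rw [Finset.mem_Ico] at hk; omega
    · intro k hk; rw [Finset.mem_Ico] at hk; omega
    · intro k hk; rw [Finset.mem_Ico] at hk
      rw [Nat.choose_symm (by omega), show 2 * p - (2 * p - k) = k by omega]
  simp only [mul_add, Finset.sum_add_distrib, h]
  simp
  ring

lemma binSum_prime_split {p : ℕ} (hp : 0 < p) (u : ℕ → ℤ) :
    binSum p u = u 0 + u p + ∑ j ∈ Finset.Ico 1 p, (p.choose j : ℤ) * u j := by
  rw [binSum, Finset.sum_range_succ, Finset.range_eq_Ico, Finset.sum_eq_sum_Ico_succ_bot hp]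
  simp
  ring

lemma sum_choose_reflect (p : ℕ) (u : ℕ → ℤ) :
    ∑ j ∈ Finset.Ico 1 p, (p.choose j : ℤ) * u (p - j)
      = ∑ j ∈ Finset.Ico 1 p, (p.choose j : ℤ) * u j := by
  refine Finset.sum_bij' (fun k _ => p - k) (fun k _ => p - k) ?_ ?_ ?_ ?_ ?_
  · intro k hk; rw [Finset.mem_Ico] at hk ⊢; omega
  · intro k hk; rw [Finset.mem_Ico] at hk ⊢; omega
  · intro k hk; rw [Finset.mem_Ico] at hk; omega
  · intro k hk; rw [Finset.mem_Ico] at hk; omega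
  · intro k hk; rw [Finset.mem_Ico] at hk
    rw [Nat.choose_symm (by omega)]

/-- A weighted sum over row `4 p` of Pascal's triangle, folded to the range `0 < j < p`. -/
lemma binSum_four_mul_fold {p : ℕ} [Fact p.Prime] (hp : 3 < p) (w : ℕ → ℤ) :
    binSum (4 * p) w ≡ w 0 + w (4 * p) + 4 * (w p + w (3 * p)) + 6 * w (2 * p)
      + ∑ j ∈ Finset.Ico 1 p, (6 * ((2 * p).choose j : ℤ) - 8 * (p.choose j : ℤ)) *
        (w j + w (4 * p - j) + 2 * w (p + j) + 2 * w (3 * p - j) + w (2 * p - j) + w (2 * p + j))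
      [ZMOD (p : ℤ) ^ 3] := by
  refine (binSum_four_mul w).trans ?_
  rw [binSum_two_mul_split (by omega), binSum_prime_split (by omega)]
  set f : ℕ → ℤ := fun j =>
    w j + w (4 * p - j) + 2 * w (p + j) + 2 * w (3 * p - j) + w (2 * p - j) + w (2 * p + j) with hf
  set u : ℕ → ℤ := fun k => w k + 3 * w (p + k) + 3 * w (2 * p + k) + w (3 * p + k) with hu
  -- `u` and `f` differ, but `u j + u (p - j) = f j + f (p - j)`, which suffices because `C(p, j)`
  -- is symmetric.
  have hsym : ∑ j ∈ Finset.Ico 1 p, (p.choose j : ℤ) * u j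
      = ∑ j ∈ Finset.Ico 1 p, (p.choose j : ℤ) * f j := by
    have h1 := sum_choose_reflect p u
    have h2 := sum_choose_reflect p f
    have h3 : ∑ j ∈ Finset.Ico 1 p, (p.choose j : ℤ) * u (p - j)
          + ∑ j ∈ Finset.Ico 1 p, (p.choose j : ℤ) * u j
        = ∑ j ∈ Finset.Ico 1 p, (p.choose j : ℤ) * f (p - j)
          + ∑ j ∈ Finset.Ico 1 p, (p.choose j : ℤ) * f j := by
      rw [← Finset.sum_add_distrib, ← Finset.sum_add_distrib]
      refine Finset.sum_congr rfl fun j hj => ?_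
      rw [Finset.mem_Ico] at hj
      simp only [hf, hu]
      rw [show p + (p - j) = 2 * p - j by omega, show 2 * p + (p - j) = 3 * p - j by omega,
        show 3 * p + (p - j) = 4 * p - j by omega, show 4 * p - (p - j) = 3 * p + j by omega,
        show 3 * p - (p - j) = 2 * p + j by omega, show 2 * p - (p - j) = p + j by omega]
      ring
    linarith
  have hv : ∑ j ∈ Finset.Ico 1 p, ((2 * p).choose j : ℤ) *
      ((w j + 2 * w (p + j) + w (2 * p + j))
        + (w (2 * p - j) + 2 * w (p + (2 * p - j)) + w (2 * p + (2 * p - j))))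
      = ∑ j ∈ Finset.Ico 1 p, ((2 * p).choose j : ℤ) * f j := by
    refine Finset.sum_congr rfl fun j hj => ?_
    rw [Finset.mem_Ico] at hj
    simp only [hf]
    rw [show p + (2 * p - j) = 3 * p - j by omega, show 2 * p + (2 * p - j) = 4 * p - j by omega]
    ring
  have hsplit : ∑ j ∈ Finset.Ico 1 p,
        (6 * ((2 * p).choose j : ℤ) - 8 * (p.choose j : ℤ)) * f j
      = 6 * ∑ j ∈ Finset.Ico 1 p, ((2 * p).choose j : ℤ) * f j
        - 8 * ∑ j ∈ Finset.Ico 1 p, (p.choose j : ℤ) * f j := by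
    rw [Finset.mul_sum, Finset.mul_sum, ← Finset.sum_sub_distrib]
    exact Finset.sum_congr rfl fun j _ => by ring
  rw [hv, hsym]
  change _ ≡ _ + ∑ j ∈ Finset.Ico 1 p,
    (6 * ((2 * p).choose j : ℤ) - 8 * (p.choose j : ℤ)) * f j [ZMOD _]
  rw [hsplit]
  obtain ⟨c, hc⟩ := (Int.modEq_iff_dvd.1 (wolstenholme hp))
  rw [Int.modEq_iff_dvd]
  refine ⟨c * (6 * (w p + 2 * w (2 * p) + w (3 * p))), ?_⟩
  simp only [add_zero, show p + p = 2 * p by ring, show p + 2 * p = 3 * p by ring,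
    show 2 * p + p = 3 * p by ring, show 2 * p + 2 * p = 4 * p by ring,
    show 3 * p + p = 4 * p by ring]
  linear_combination 6 * (w p + 2 * w (2 * p) + w (3 * p)) * hc

/-- The even and the odd part of row `4 p` agree modulo `p ^ 3` on `0 < j < p`. -/
lemma sum_alternating_choose {p : ℕ} [Fact p.Prime] (hp : 3 < p) :
    ∑ j ∈ Finset.Ico 1 p, (6 * ((2 * p).choose j : ℤ) - 8 * (p.choose j : ℤ)) * (-1) ^ j
      ≡ 0 [ZMOD (p : ℤ) ^ 3] := by
  have hodd : Odd p := (Fact.out : p.Prime).odd_of_ne_two (by omega)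
  have h1 : ∀ N : ℕ, N ≠ 0 → binSum N (fun k => (-1) ^ k) = 0 := by
    intro N hN
    rw [binSum, ← Int.alternating_sum_range_choose_of_ne hN]
    exact Finset.sum_congr rfl fun _ _ => mul_comm _ _
  have h2 := h1 (2 * p) (by omega)
  have h3 := h1 p (by omega)
  rw [binSum_two_mul_split (by omega)] at h2
  rw [binSum_prime_split (by omega)] at h3
  have h4 : ∑ j ∈ Finset.Ico 1 p, ((2 * p).choose j : ℤ) * ((-1) ^ j + (-1) ^ (2 * p - j))
      = 2 * ∑ j ∈ Finset.Ico 1 p, ((2 * p).choose j : ℤ) * (-1) ^ j := by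
    rw [Finset.mul_sum]
    refine Finset.sum_congr rfl fun j hj => ?_
    rw [Finset.mem_Ico] at hj
    have : (-1 : ℤ) ^ (2 * p - j) = (-1) ^ j := by
      rw [neg_one_pow_congr]
      rw [Nat.even_sub (by omega)]
      simp
    rw [this]; ring
  rw [h4, hodd.neg_one_pow, Even.neg_one_pow (n := 2 * p) (by simp)] at h2
  rw [hodd.neg_one_pow] at h3
  obtain ⟨c, hc⟩ := (Int.modEq_iff_dvd.1 (wolstenholme hp))
  have hsplit : ∑ j ∈ Finset.Ico 1 p,
        (6 * ((2 * p).choose j : ℤ) - 8 * (p.choose j : ℤ)) * (-1) ^ j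
      = 6 * ∑ j ∈ Finset.Ico 1 p, ((2 * p).choose j : ℤ) * (-1) ^ j
        - 8 * ∑ j ∈ Finset.Ico 1 p, (p.choose j : ℤ) * (-1) ^ j := by
    rw [Finset.mul_sum, Finset.mul_sum, ← Finset.sum_sub_distrib]
    exact Finset.sum_congr rfl fun j _ => by ring
  rw [hsplit, Int.modEq_iff_dvd]
  refine ⟨3 * c, ?_⟩
  linear_combination 3 * hc - 3 * h2 + 8 * h3

/-! ### Weights modulo 8 and Pell numbers -/

/-- Pascal's rule for binomially weighted sums. -/
lemma binSum_succ (N : ℕ) (w : ℕ → ℤ) :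
    binSum (N + 1) w = binSum N (fun k => w k + w (k + 1)) := by
  have h := Finset.sum_choose_succ_mul (R := ℤ) (fun i _ => w i) N
  simp only [binSum, mul_add, Finset.sum_add_distrib]
  exact h

/-- The weighted sum over row `2 n` of Pascal's triangle, with weight depending on the distance
to the central entry modulo `8`. -/
def centralSum (n : ℕ) (f : ZMod 8 → ℤ) : ℤ := binSum (2 * n) fun k => f ((k : ZMod 8) - n)

lemma centralSum_zero (f : ZMod 8 → ℤ) : centralSum 0 f = f 0 := by
  simp [centralSum, binSum]

/-- Pascal's rule twice. The operator on weights has eigenfunctions `cos (π k x / 4)` with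
eigenvalues `2 + 2 cos (π k / 4)`. -/
lemma centralSum_succ (n : ℕ) (f : ZMod 8 → ℤ) :
    centralSum (n + 1) f = centralSum n (fun x => f (x - 1) + 2 * f x + f (x + 1)) := by
  rw [centralSum, show 2 * (n + 1) = 2 * n + 1 + 1 by ring, binSum_succ, binSum_succ, centralSum]
  congr 1
  funext k
  push_cast
  rw [show (k : ZMod 8) - (n + 1) = k - n - 1 by ring,
    show (k : ZMod 8) + 1 - (n + 1) = k - n by ring,
    show (k : ZMod 8) + 1 + 1 - (n + 1) = k - n + 1 by ring]
  ring

lemma centralSum_add (n : ℕ) (f g : ZMod 8 → ℤ) :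
    centralSum n (fun x => f x + g x) = centralSum n f + centralSum n g := by
  simp [centralSum, binSum, mul_add, Finset.sum_add_distrib]

lemma centralSum_const_mul (n : ℕ) (c : ℤ) (f : ZMod 8 → ℤ) :
    centralSum n (fun x => c * f x) = c * centralSum n f := by
  simp [centralSum, binSum, Finset.mul_sum, mul_left_comm c]

/-- The sign `(-1) ^ x` on `ℤ/8ℤ`. -/
def signEight (x : ZMod 8) : ℤ := if x = 0 ∨ x = 2 ∨ x = 4 ∨ x = 6 then 1 else -1

/-- The function `2 cos (π x / 2)` on `ℤ/8ℤ`. -/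
def cosQuarter (x : ZMod 8) : ℤ := if x = 0 ∨ x = 4 then 2 else if x = 2 ∨ x = 6 then -2 else 0

/-- The function `2 cos (π x / 4) + 2 cos (3 π x / 4)` on `ℤ/8ℤ`. -/
def cosEighthEven (x : ZMod 8) : ℤ := if x = 0 then 4 else if x = 4 then -4 else 0

/-- The function `2 √2 (cos (π x / 4) - cos (3 π x / 4))` on `ℤ/8ℤ`. -/
def cosEighthOdd (x : ZMod 8) : ℤ :=
  if x = 1 ∨ x = 7 then 4 else if x = 3 ∨ x = 5 then -4 else 0

lemma centralSum_one (n : ℕ) : centralSum n (fun _ => 1) = 4 ^ n := by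
  induction n with
  | zero => rw [centralSum_zero, pow_zero]
  | succ n ih =>
    rw [centralSum_succ, show (fun _ : ZMod 8 => (1 : ℤ) + 2 * 1 + 1) = fun _ => 4 * 1 by
      funext; norm_num, centralSum_const_mul, ih, pow_succ']

lemma centralSum_signEight {n : ℕ} (hn : 0 < n) : centralSum n signEight = 0 := by
  obtain ⟨n, rfl⟩ := Nat.exists_eq_succ_of_ne_zero hn.ne'
  have h : ∀ x : ZMod 8, signEight (x - 1) + 2 * signEight x + signEight (x + 1) = 0 * 1 := by
    decide
  rw [Nat.succ_eq_add_one, centralSum_succ, funext h, centralSum_const_mul, zero_mul]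

lemma centralSum_cosQuarter (n : ℕ) : centralSum n cosQuarter = 2 * 2 ^ n := by
  induction n with
  | zero => rw [centralSum_zero]; rfl
  | succ n ih =>
    have h : ∀ x : ZMod 8,
        cosQuarter (x - 1) + 2 * cosQuarter x + cosQuarter (x + 1) = 2 * cosQuarter x := by
      decide
    rw [centralSum_succ, funext h, centralSum_const_mul, ih, pow_succ']

/-- The eigenvalues `2 ± √2 = √2 (√2 ± 1)` are conjugate, so an integral basis of the two eigenlines
is used. -/
lemma centralSum_cosEighth_succ (n : ℕ) :
    centralSum (n + 1) cosEighthEven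
        = 2 * centralSum n cosEighthEven + centralSum n cosEighthOdd ∧
      centralSum (n + 1) cosEighthOdd
        = 2 * centralSum n cosEighthEven + 2 * centralSum n cosEighthOdd := by
  have h1 : ∀ x : ZMod 8, cosEighthEven (x - 1) + 2 * cosEighthEven x + cosEighthEven (x + 1)
      = 2 * cosEighthEven x + cosEighthOdd x := by decide
  have h2 : ∀ x : ZMod 8, cosEighthOdd (x - 1) + 2 * cosEighthOdd x + cosEighthOdd (x + 1)
      = 2 * cosEighthEven x + 2 * cosEighthOdd x := by decide
  rw [centralSum_succ, centralSum_succ, funext h1, funext h2, centralSum_add, centralSum_add,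
    centralSum_const_mul, centralSum_const_mul]
  exact ⟨rfl, rfl⟩

lemma pellNumber_add_two (n : ℕ) :
    pellNumber (n + 2) = 2 * pellNumber (n + 1) + pellNumber n := by
  rw [pellNumber]

lemma centralSum_cosEighth_even (n : ℕ) :
    centralSum (2 * n) cosEighthEven
        = 4 * 2 ^ n * ((pellNumber (2 * n + 1) : ℤ) - pellNumber (2 * n)) ∧
      centralSum (2 * n) cosEighthOdd = 8 * 2 ^ n * (pellNumber (2 * n) : ℤ) := by
  induction n with
  | zero => exact ⟨by rw [mul_zero, centralSum_zero]; rfl, by rw [mul_zero, centralSum_zero]; rfl⟩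
  | succ n ih =>
    obtain ⟨h1, h2⟩ := centralSum_cosEighth_succ (2 * n)
    obtain ⟨h3, h4⟩ := centralSum_cosEighth_succ (2 * n + 1)
    rw [show 2 * (n + 1) = 2 * n + 1 + 1 by ring, h3, h4, h1, h2, ih.1, ih.2,
      pellNumber_add_two (2 * n + 1), pellNumber_add_two (2 * n)]
    push_cast
    constructor <;> ring

lemma centralSum_cosEighthEven_odd (n : ℕ) :
    centralSum (2 * n + 1) cosEighthEven = 8 * 2 ^ n * (pellNumber (2 * n + 1) : ℤ) := by
  rw [(centralSum_cosEighth_succ (2 * n)).1, (centralSum_cosEighth_even n).1,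
    (centralSum_cosEighth_even n).2]
  ring

lemma signEight_natCast (k : ℕ) : signEight (k : ZMod 8) = (-1) ^ k := by
  have h : ∀ x : ZMod 8, signEight (x + 1) = -signEight x := by decide
  induction k with
  | zero => rfl
  | succ k ih => rw [Nat.cast_succ, h, ih, pow_succ]; ring

lemma natCast_zmod_eight_of_odd {p : ℕ} (hp : Odd p) :
    (p : ZMod 8) = 1 ∨ (p : ZMod 8) = 3 ∨ (p : ZMod 8) = 5 ∨ (p : ZMod 8) = 7 := by
  have h : ∀ x : ZMod 8, signEight x = -1 → x = 1 ∨ x = 3 ∨ x = 5 ∨ x = 7 := by decide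
  exact h _ (by rw [signEight_natCast, hp.neg_one_pow])

/-! ### Isolating the residue class of `p` -/

/-- A weight on `ℤ/8ℤ` whose folding isolates the residue class of an odd `q`. -/
def isolatingWeight (q x : ZMod 8) : ℤ :=
  1 + 4 * signEight x + 2 * cosQuarter x + 4 * cosEighthEven x
    + (-2 * ZMod.χ₈ q) * cosEighthOdd x

/-- In `y = x - q` the fold is `2 (f (y - q) + 2 f y + f (y + q))` for even `f`. The coefficients
invert its eigenvalues, giving the expansion of `64 * 1_{y = 0}` except for the sign character,
which the fold kills; hence the leftover `8 * signEight x`. The sign term of the weight contributes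
nothing anywhere. -/
lemma isolatingWeight_fold :
    ∀ q : ZMod 8, (q = 1 ∨ q = 3 ∨ q = 5 ∨ q = 7) → ∀ x : ZMod 8,
      isolatingWeight q (x - 2 * q) + isolatingWeight q (4 * q - x - 2 * q)
        + 2 * isolatingWeight q (q + x - 2 * q) + 2 * isolatingWeight q (3 * q - x - 2 * q)
        + isolatingWeight q (2 * q - x - 2 * q) + isolatingWeight q (2 * q + x - 2 * q)
      = 64 * (if x = q then 1 else 0) + 8 * signEight x := by
  decide

lemma isolatingWeight_ends :
    ∀ q : ZMod 8, (q = 1 ∨ q = 3 ∨ q = 5 ∨ q = 7) →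
      isolatingWeight q (0 - 2 * q) + isolatingWeight q (4 * q - 2 * q)
        + 4 * (isolatingWeight q (q - 2 * q) + isolatingWeight q (3 * q - 2 * q))
        + 6 * isolatingWeight q (2 * q - 2 * q) = 64 := by
  decide

/-- Evaluation of `P_{2p - (2/p)}` through neighbouring Pell numbers. -/
lemma pellNumber_two_mul_sub_legendreSym {p : ℕ} [Fact p.Prime] (hp : 3 < p) :
    (pellNumber (2 * (p : ℤ) - legendreSym p 2).toNat : ℤ)
      = pellNumber (2 * p + 1) - pellNumber (2 * p) - ZMod.χ₈ p * pellNumber (2 * p) := by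
  have hodd : Odd p := (Fact.out : p.Prime).odd_of_ne_two (by omega)
  have hrec : pellNumber (2 * p + 1) = 2 * pellNumber (2 * p) + pellNumber (2 * p - 1) := by
    have := pellNumber_add_two (2 * p - 1)
    rwa [show 2 * p - 1 + 2 = 2 * p + 1 by omega, show 2 * p - 1 + 1 = 2 * p by omega] at this
  have hχ : ∀ q : ZMod 8, (q = 1 ∨ q = 3 ∨ q = 5 ∨ q = 7) → ZMod.χ₈ q = 1 ∨ ZMod.χ₈ q = -1 := by
    decide
  rw [legendreSym.at_two (by omega)]
  rcases hχ _ (natCast_zmod_eight_of_odd hodd) with h | h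
  · rw [h, show (2 * (p : ℤ) - 1).toNat = 2 * p - 1 by omega, hrec]
    push_cast
    ring
  · rw [h, show (2 * (p : ℤ) - -1).toNat = 2 * p + 1 by omega]
    ring

/-- The residues `0 < j < p` congruent to `p` modulo `8`. -/
def residueClassEight (p : ℕ) : Finset ℕ :=
  (Finset.Ico 1 p).filter fun j => (j : ZMod 8) = (p : ZMod 8)

lemma sum_residueClassEight (p : ℕ) (c : ℕ → ℤ) :
    ∑ j ∈ residueClassEight p, c j
      = ∑ j ∈ Finset.Ico 1 p, c j * (if (j : ZMod 8) = (p : ZMod 8) then 1 else 0) := by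
  rw [residueClassEight, Finset.sum_filter]
  exact Finset.sum_congr rfl fun j _ => by split_ifs <;> ring

lemma sum_choose_residueClassEight {p : ℕ} [Fact p.Prime] (hp : 3 < p) :
    64 * ∑ j ∈ residueClassEight p, (6 * ((2 * p).choose j : ℤ) - 8 * (p.choose j : ℤ))
      ≡ 4 ^ (2 * p) + 4 * 2 ^ (2 * p)
        + 16 * 2 ^ p * (pellNumber (2 * (p : ℤ) - legendreSym p 2).toNat : ℤ) - 64
      [ZMOD (p : ℤ) ^ 3] := by
  have hodd : Odd p := (Fact.out : p.Prime).odd_of_ne_two (by omega)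
  have hq := natCast_zmod_eight_of_odd hodd
  set w : ℕ → ℤ := fun k => isolatingWeight p ((k : ZMod 8) - (2 * p : ℕ)) with hw
  have hfold := binSum_four_mul_fold hp w
  have hends : w 0 + w (4 * p) + 4 * (w p + w (3 * p)) + 6 * w (2 * p) = 64 := by
    rw [← isolatingWeight_ends p hq]
    simp only [hw]
    push_cast
    rfl
  have hbr : ∀ j ∈ Finset.Ico 1 p, (6 * ((2 * p).choose j : ℤ) - 8 * (p.choose j : ℤ)) *
        (w j + w (4 * p - j) + 2 * w (p + j) + 2 * w (3 * p - j) + w (2 * p - j) + w (2 * p + j))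
      = 64 * ((6 * ((2 * p).choose j : ℤ) - 8 * (p.choose j : ℤ))
          * (if (j : ZMod 8) = (p : ZMod 8) then 1 else 0))
        + 8 * ((6 * ((2 * p).choose j : ℤ) - 8 * (p.choose j : ℤ)) * (-1) ^ j) := by
    intro j hj
    rw [Finset.mem_Ico] at hj
    have h := isolatingWeight_fold p hq j
    have h' : w j + w (4 * p - j) + 2 * w (p + j) + 2 * w (3 * p - j) + w (2 * p - j)
        + w (2 * p + j) = 64 * (if (j : ZMod 8) = (p : ZMod 8) then 1 else 0) + 8 * (-1) ^ j := by
      rw [← signEight_natCast, ← h]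
      simp only [hw]
      rw [Nat.cast_sub (by omega), Nat.cast_sub (by omega), Nat.cast_sub (by omega)]
      push_cast
      rfl
    rw [h']
    ring
  rw [hends, Finset.sum_congr rfl hbr, Finset.sum_add_distrib, ← Finset.mul_sum, ← Finset.mul_sum,
    ← sum_residueClassEight] at hfold
  have hval : binSum (4 * p) w = 4 ^ (2 * p) + 4 * 2 ^ (2 * p)
        + 16 * 2 ^ p * (pellNumber (2 * (p : ℤ) - legendreSym p 2).toNat : ℤ) := by
    have h1 : binSum (4 * p) w = centralSum (2 * p) (isolatingWeight p) := by
      rw [centralSum, show 2 * (2 * p) = 4 * p by ring]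
    rw [h1]
    unfold isolatingWeight
    rw [centralSum_add, centralSum_add, centralSum_add, centralSum_add, centralSum_const_mul,
      centralSum_const_mul, centralSum_const_mul, centralSum_const_mul, centralSum_one,
      centralSum_signEight (by omega), centralSum_cosQuarter, (centralSum_cosEighth_even p).1,
      (centralSum_cosEighth_even p).2, pellNumber_two_mul_sub_legendreSym hp]
    ring
  rw [hval] at hfold
  obtain ⟨a, ha⟩ := Int.modEq_iff_dvd.1 hfold
  obtain ⟨b, hb⟩ := Int.modEq_iff_dvd.1 (sum_alternating_choose hp)
  rw [Int.modEq_iff_dvd]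
  refine ⟨-a - 8 * b, ?_⟩
  linear_combination -ha - 8 * hb

/-- The weight is `8` times the indicator of `0`, so row `2p` retains its centre and the pairs `j`,
`2p - j`. -/
lemma sum_choose_two_mul_residueClassEight {p : ℕ} [Fact p.Prime] (hp : 3 < p) :
    8 * (((2 * p).choose p : ℤ) + 2 * ∑ j ∈ residueClassEight p, ((2 * p).choose j : ℤ))
      = 4 ^ p + 2 * 2 ^ p + 8 * 2 ^ ((p - 1) / 2) * (pellNumber p : ℤ) := by
  obtain ⟨n, hn⟩ := (Fact.out : p.Prime).odd_of_ne_two (by omega)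
  have hq := natCast_zmod_eight_of_odd ⟨n, hn⟩
  set f : ZMod 8 → ℤ := fun x => 1 + signEight x + cosQuarter x + cosEighthEven x with hf
  have hfx : ∀ x : ZMod 8, 1 + signEight x + cosQuarter x + cosEighthEven x
      = if x = 0 then 8 else 0 := by decide
  have hf0 : ∀ q : ZMod 8, (q = 1 ∨ q = 3 ∨ q = 5 ∨ q = 7) →
      (1 + signEight (-q) + cosQuarter (-q) + cosEighthEven (-q) = 0 ∧
        1 + signEight q + cosQuarter q + cosEighthEven q = 0) := by decide
  have h1 : centralSum p f = 4 ^ p + 2 * 2 ^ p + 8 * 2 ^ ((p - 1) / 2) * (pellNumber p : ℤ) := by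
    have h2 := centralSum_cosEighthEven_odd n
    rw [← hn] at h2
    rw [hf, centralSum_add, centralSum_add, centralSum_add, centralSum_one,
      centralSum_signEight (by omega), centralSum_cosQuarter, h2, show (p - 1) / 2 = n by omega]
    ring
  rw [← h1, centralSum, binSum_two_mul_split (by omega), sum_residueClassEight, mul_add,
    Finset.mul_sum, Finset.mul_sum]
  have h3 : f (((0 : ℕ) : ZMod 8) - p) = 0 := by
    rw [Nat.cast_zero, zero_sub]; exact (hf0 p hq).1
  have h4 : f (((2 * p : ℕ) : ZMod 8) - p) = 0 := by
    rw [show ((2 * p : ℕ) : ZMod 8) - p = p by push_cast; ring]; exact (hf0 p hq).2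
  have h5 : f ((p : ZMod 8) - p) = 8 := by rw [sub_self]; rfl
  rw [h3, h4, h5]
  have h6 : ∀ j ∈ Finset.Ico 1 p,
      ((2 * p).choose j : ℤ) * (f ((j : ZMod 8) - p) + f (((2 * p - j : ℕ) : ZMod 8) - p))
      = 8 * (2 * (((2 * p).choose j : ℤ) * (if (j : ZMod 8) = (p : ZMod 8) then 1 else 0))) := by
    intro j hj
    rw [Finset.mem_Ico] at hj
    rw [Nat.cast_sub (by omega), show ((2 * p : ℕ) : ZMod 8) - j - p = -(j - p) by push_cast; ring]
    simp only [hf, hfx, neg_eq_zero, sub_eq_zero]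
    split_ifs <;> ring
  rw [Finset.sum_congr rfl h6]
  ring

/-! ### The harmonic sum and the conclusion -/

lemma harmonicSumMod_eight (p : ℕ) :
    harmonicSumMod (p : ℤ) 8 (p - 1) = ∑ j ∈ residueClassEight p, 1 / (j : ℚ) := by
  rw [harmonicSumMod, residueClassEight]
  refine Finset.sum_congr ?_ fun _ _ => rfl
  ext k
  have h : ((k : ℤ) ≡ (p : ℤ) [ZMOD ((8 : ℕ) : ℤ)]) ↔ (k : ZMod 8) = (p : ZMod 8) := by
    rw [← ZMod.intCast_eq_intCast_iff]
    simp
  rw [Finset.mem_filter, Finset.mem_filter, h, Finset.mem_Icc, Finset.mem_Ico]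
  constructor <;> rintro ⟨h1, h2⟩ <;> refine ⟨?_, h2⟩ <;> omega

lemma odd_of_mem_residueClassEight {p j : ℕ} (hp : Odd p) (hj : j ∈ residueClassEight p) :
    Odd j := by
  rw [residueClassEight, Finset.mem_filter] at hj
  have h := signEight_natCast j
  rw [hj.2, signEight_natCast, hp.neg_one_pow] at h
  by_contra hj'
  rw [Nat.not_odd_iff_even] at hj'
  rw [hj'.neg_one_pow] at h
  norm_num at h

/-- The harmonic sum in terms of binomial coefficients, with denominators cleared. -/
lemma exists_harmonicSumMod_eq {p : ℕ} [Fact p.Prime] (hp : 3 < p) :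
    ∃ m : ℤ, 4 * (p : ℚ) * ((p - 1).factorial : ℚ) * harmonicSumMod (p : ℤ) 8 (p - 1)
      = (((p - 1).factorial : ℤ) * ∑ j ∈ residueClassEight p,
          (8 * (p.choose j : ℤ) - 2 * ((2 * p).choose j : ℤ)) + (p : ℤ) ^ 3 * m : ℤ) := by
  have hodd : Odd p := (Fact.out : p.Prime).odd_of_ne_two (by omega)
  have h : ∀ j, ∃ m : ℤ, j ∈ residueClassEight p →
      4 * (p : ℚ) * ((p - 1).factorial : ℚ) * (1 / (j : ℚ))
        = (((p - 1).factorial : ℤ) * (8 * (p.choose j : ℤ) - 2 * ((2 * p).choose j : ℤ))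
          + (p : ℤ) ^ 3 * m : ℤ) := by
    intro j
    by_cases hj : j ∈ residueClassEight p
    · have hjo := odd_of_mem_residueClassEight hodd hj
      have hj' : 1 ≤ j ∧ j < p := by
        rw [residueClassEight, Finset.mem_filter, Finset.mem_Ico] at hj
        exact hj.1
      obtain ⟨d, hd⟩ := Nat.dvd_factorial (show 0 < j by omega) (show j ≤ p - 1 by omega)
      obtain ⟨c, hc⟩ := Int.modEq_iff_dvd.1 (mul_choose_modEq hj'.2 hjo)
      refine ⟨d * c, fun _ => ?_⟩
      have hj0 : (j : ℚ) ≠ 0 := by exact_mod_cast (show j ≠ 0 by omega)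
      rw [hd]
      have hc' : (4 * p : ℚ) - j * (8 * (p.choose j : ℚ) - 2 * ((2 * p).choose j : ℚ))
          = p ^ 3 * c := by exact_mod_cast hc
      push_cast
      field_simp
      linear_combination (d : ℚ) * hc'
    -- Default value off the class, so that `choose` yields a total function.
    · exact ⟨0, fun h => absurd h hj⟩
  choose m hm using h
  refine ⟨∑ j ∈ residueClassEight p, m j, ?_⟩
  rw [harmonicSumMod_eight, Finset.mul_sum, Finset.sum_congr rfl hm, Finset.mul_sum,
    Finset.mul_sum, ← Finset.sum_add_distrib, Int.cast_sum]

theorem theorem4 (p : ℕ) [Fact p.Prime] (hp : 3 < p) :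
    RatModEq (p ^ 2) (harmonicSumMod (p : ℤ) 8 (p - 1))
      (((2 : ℚ) ^ (2 * p - 4) + 2 ^ (p - 3) + 2 ^ ((p - 3) / 2) * (pellNumber p : ℚ) - 1) / (p : ℚ)
        - ((2 : ℚ) ^ (4 * p - 6) + 2 ^ (2 * p - 4)
            + 2 ^ (p - 2) * (pellNumber (2 * (p : ℤ) - legendreSym p 2).toNat : ℚ) - 1)
          / (4 * (p : ℚ))) := by
  have hpp : p.Prime := Fact.out
  have hodd : Odd p := hpp.odd_of_ne_two (by omega)
  set P : ℕ := pellNumber (2 * (p : ℤ) - legendreSym p 2).toNat with hP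
  set s : ℤ := ∑ j ∈ residueClassEight p, ((2 * p).choose j : ℤ) with hs
  set t : ℤ := ∑ j ∈ residueClassEight p, (p.choose j : ℤ) with ht
  set F : ℤ := 2 ^ (2 * p - 4) + 2 ^ (p - 3) + 2 ^ ((p - 3) / 2) * (pellNumber p : ℤ) - 1 with hF
  set S : ℤ := 2 ^ (4 * p - 6) + 2 ^ (2 * p - 4) + 2 ^ (p - 2) * (P : ℤ) - 1 with hS
  have hcop : IsCoprime ((p : ℤ) ^ 3) ((2 : ℤ) ^ 6) := by
    apply IsCoprime.pow
    exact Nat.isCoprime_iff_coprime.2 (Nat.coprime_two_right.2 hodd)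
  have h64 : (64 : ℤ) * S = 4 ^ (2 * p) + 4 * 2 ^ (2 * p) + 16 * 2 ^ p * (P : ℤ) - 64 := by
    obtain ⟨k, rfl⟩ : ∃ k, p = k + 3 := ⟨p - 3, by omega⟩
    rw [hS, show 4 * (k + 3) - 6 = 4 * k + 6 by omega, show 2 * (k + 3) - 4 = 2 * k + 2 by omega,
      show k + 3 - 2 = k + 1 by omega, show (4 : ℤ) = 2 ^ 2 by norm_num, ← pow_mul]
    ring
  have h16 : (16 : ℤ) * F
      = 4 ^ p + 2 * 2 ^ p + 8 * 2 ^ ((p - 1) / 2) * (pellNumber p : ℤ) - 16 := by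
    rw [show (p - 1) / 2 = (p - 3) / 2 + 1 by omega, hF]
    generalize pellNumber p = u
    generalize (p - 3) / 2 = v
    obtain ⟨k, rfl⟩ : ∃ k, p = k + 3 := ⟨p - 3, by omega⟩
    rw [show 2 * (k + 3) - 4 = 2 * k + 2 by omega, show k + 3 - 3 = k by omega,
      show (4 : ℤ) = 2 ^ 2 by norm_num, ← pow_mul]
    ring
  have hsum : ∑ j ∈ residueClassEight p, (6 * ((2 * p).choose j : ℤ) - 8 * (p.choose j : ℤ))
      = 6 * s - 8 * t := by
    rw [hs, ht, Finset.mul_sum, Finset.mul_sum, Finset.sum_sub_distrib]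
  have hsum' : ∑ j ∈ residueClassEight p, (8 * (p.choose j : ℤ) - 2 * ((2 * p).choose j : ℤ))
      = 8 * t - 2 * s := by
    rw [hs, ht, Finset.mul_sum, Finset.mul_sum, Finset.sum_sub_distrib]
  -- Modulo `p ^ 3`, `s ≡ F` and `6s - 8t ≡ S`; the factor `64` is a unit.
  have hdvd : (p : ℤ) ^ 3 ∣ (8 * t - 2 * s) - (4 * F - S) := by
    apply hcop.dvd_of_dvd_mul_left
    obtain ⟨a, ha⟩ := Int.modEq_iff_dvd.1 (sum_choose_residueClassEight hp)
    obtain ⟨b, hb⟩ := Int.modEq_iff_dvd.1 (wolstenholme hp)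
    have hx := sum_choose_two_mul_residueClassEight hp
    rw [hsum, ← hP, ← h64] at ha
    exact ⟨a + 128 * b, by linear_combination ha + 128 * hb - 16 * h16 + 16 * hx⟩
  obtain ⟨c, hc⟩ := hdvd
  obtain ⟨m, hm⟩ := exists_harmonicSumMod_eq hp
  rw [hsum'] at hm
  set D : ℕ := (p - 1).factorial with hD
  have hp0 : (p : ℚ) ≠ 0 := by exact_mod_cast hpp.ne_zero
  have hD0 : (D : ℚ) ≠ 0 := by exact_mod_cast Nat.factorial_ne_zero _
  -- Dividing `D * (p ^ 3 * c) + p ^ 3 * m` by `4 * p * D` leaves `p ^ 2` times this quotient, and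
  -- `4 * D` is prime to `p`.
  refine ⟨((D * c + m : ℤ) : ℚ) / ((4 * D : ℤ) : ℚ), ?_, ?_⟩
  · have hden : ((((D * c + m : ℤ) : ℚ) / ((4 * D : ℤ) : ℚ)).den : ℤ) ∣ (4 * D : ℤ) := by
      rw [← Rat.divInt_eq_div]
      exact Rat.den_dvd _ _
    have hden' : (((D * c + m : ℤ) : ℚ) / ((4 * D : ℤ) : ℚ)).den ∣ 4 * D := by exact_mod_cast hden
    refine Nat.Coprime.coprime_dvd_left hden' (Nat.Coprime.pow_right 2 (Nat.Coprime.mul_left ?_ ?_))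
    · exact Nat.Coprime.pow_left 2 (Nat.coprime_two_left.2 hodd)
    · exact (hpp.coprime_factorial_of_lt (by omega)).symm
  · have hc' : (8 * t - 2 * s : ℚ) - (4 * F - S) = p ^ 3 * c := by exact_mod_cast hc
    have hFq : (2 : ℚ) ^ (2 * p - 4) + 2 ^ (p - 3) + 2 ^ ((p - 3) / 2) * (pellNumber p : ℚ) - 1
        = F := by rw [hF]; push_cast; ring
    have hSq : (2 : ℚ) ^ (4 * p - 6) + 2 ^ (2 * p - 4) + 2 ^ (p - 2) * (P : ℚ) - 1 = S := by
      rw [hS]; push_cast; ring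
    rw [hFq, hSq]
    push_cast at hm ⊢
    field_simp
    linear_combination hm + (D : ℚ) * hc'
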